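/- Fix $\mathbb K\in\{\mathbb R,\mathbb C\}$ and let $\kappa$ be an infinite cardinal. The density of a topological space is the least cardinality of a dense subset of it. Let $S_\kappa$ be the free monoid on $\kappa$ generators, and let $\ell_1(S_\kappa)$ be the Banach space of absolutely summable functions $S_\kappa\to\mathbb K$, which is a unital Banach algebra over $\mathbb K$ under the convolution product $(f*g)(u)=\sum_{st=u}f(s)g(t)$, that is, the product determined by $e_s*e_t=e_{st}$ for the unit vectors $e_s$. Two Banach algebras are called isomorphic if there is an algebra isomorphism between them that is a homeomorphism. Every unital Banach algebra $A$ over $\mathbb K$ of density $\kappa$ is a quotient of $\ell_1(S_\kappa)$: there is a closed two-sided ideal $I$ of $\ell_1(S_\kappa)$ such that $\ell_1(S_\kappa)/I$ is isomorphic to $A$. Moreover, there are exactly $2^\kappa$ isomorphism types of unital Banach algebras over $\mathbb K$ of density $\kappa$. -/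

import Mathlib

open Cardinal

universe u

noncomputable section

/-- The density of a topological space: the least cardinality of a dense subset. -/
def topDensity (X : Type u) [TopologicalSpace X] : Cardinal.{u} :=
  sInf {c : Cardinal.{u} | ∃ s : Set X, Dense s ∧ #s = c}

/-- The Banach space `ℓ₁(S)` of absolutely summable functions `S → 𝕜`, which carries the
convolution product below when `S` is a monoid. -/
def EllOne (𝕜 S : Type*) [RCLike 𝕜] : Type _ := lp (fun _ : S => 𝕜) 1

namespace EllOne

section Space

variable {𝕜 S : Type*} [RCLike 𝕜]

instance : NormedAddCommGroup (EllOne 𝕜 S) :=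
  inferInstanceAs (NormedAddCommGroup (lp (fun _ : S => 𝕜) 1))

instance : NormedSpace 𝕜 (EllOne 𝕜 S) :=
  inferInstanceAs (NormedSpace 𝕜 (lp (fun _ : S => 𝕜) 1))

instance : CompleteSpace (EllOne 𝕜 S) :=
  inferInstanceAs (CompleteSpace (lp (fun _ : S => 𝕜) 1))

instance : CoeFun (EllOne 𝕜 S) (fun _ => S → 𝕜) := ⟨fun f s => f.1 s⟩

theorem ext' {f g : EllOne 𝕜 S} (h : ∀ s, f s = g s) : f = g :=
  lp.ext (funext h)

theorem hasSum_norm (f : EllOne 𝕜 S) : HasSum (fun s => ‖f s‖) ‖f‖ := by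
  have := lp.hasSum_norm (p := 1) (by simp) (f : lp (fun _ : S => 𝕜) 1)
  simpa using! this

/-- The element of `ℓ₁(S)` given by an absolutely summable function. -/
def mk (f : S → 𝕜) (hf : Summable fun s => ‖f s‖) : EllOne 𝕜 S :=
  ⟨f, memℓp_gen (by simpa using hf)⟩

theorem norm_le_of_tsum_le (f : EllOne 𝕜 S) {C : ℝ} (h : ∑' s, ‖f s‖ ≤ C) : ‖f‖ ≤ C := by
  rwa [← (hasSum_norm f).tsum_eq]

open Classical in
/-- The standard unit vector `e_s`. -/
def basisVec (s : S) : EllOne 𝕜 S := lp.single 1 s (1 : 𝕜)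

open Classical in
theorem basisVec_apply (s t : S) : (basisVec s : EllOne 𝕜 S) t = if t = s then 1 else 0 := by
  change (Pi.single s (1 : 𝕜) : S → 𝕜) t = _
  exact Pi.single_apply ..

theorem clm_ext {F : Type*} [NormedAddCommGroup F] [NormedSpace 𝕜 F]
    {T U : EllOne 𝕜 S →L[𝕜] F} (h : ∀ s, T (basisVec s) = U (basisVec s)) : T = U := by
  classical
  ext f
  have key : HasSum (fun s => f s • (basisVec s : EllOne 𝕜 S)) f := by
    have h0 := lp.hasSum_single (p := 1) (by simp) (f : lp (fun _ : S => 𝕜) 1)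
    have e : (fun s => f s • (basisVec s : EllOne 𝕜 S)) =
        fun s => (lp.single 1 s (f s) : lp (fun _ : S => 𝕜) 1) := by
      funext s
      refine ext' fun t => ?_
      change f s * (basisVec s : EllOne 𝕜 S) t = (Pi.single s (f s) : S → 𝕜) t
      rw [basisVec_apply, Pi.single_apply]
      split_ifs <;> simp
    rw [e]
    exact h0
  have h1 := key.mapL T
  have h2 := key.mapL U
  simp only [map_smul, h] at h1 h2
  exact h1.unique h2

end Space

section Convolution

variable {𝕜 S : Type*} [RCLike 𝕜]

theorem summable_pair (f g : EllOne 𝕜 S) :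
    Summable fun p : S × S => ‖f p.1 * g p.2‖ :=
  (hasSum_norm f).summable.mul_norm (hasSum_norm g).summable

variable [Monoid S]

/-- The pairs `(s, t)` with `s * t = u`. -/
abbrev Fiber (u : S) : Type _ := {p : S × S // p.1 * p.2 = u}

theorem summable_fiber (f g : EllOne 𝕜 S) (u : S) :
    Summable fun p : Fiber u => ‖f p.1.1 * g p.1.2‖ :=
  (summable_pair f g).subtype _

/-- The convolution `(f * g) u = ∑_{s * t = u} f s * g t`. -/
def convFun (f g : EllOne 𝕜 S) (u : S) : 𝕜 := ∑' p : Fiber u, f p.1.1 * g p.1.2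

theorem hasSum_fiberwise (f g : EllOne 𝕜 S) :
    HasSum (fun u : S => ∑' p : Fiber u, ‖f p.1.1 * g p.1.2‖) (‖f‖ * ‖g‖) := by
  have h0 : HasSum (fun p : S × S => ‖f p.1 * g p.2‖) (‖f‖ * ‖g‖) := by
    simp only [norm_mul]
    refine (hasSum_norm f).mul (hasSum_norm g) ?_
    simpa only [norm_mul] using summable_pair f g
  have h1 := (Equiv.sigmaFiberEquiv (fun p : S × S => p.1 * p.2)).hasSum_iff.mpr h0
  exact h1.sigma fun u => (summable_fiber f g u).hasSum

theorem norm_convFun_le (f g : EllOne 𝕜 S) (u : S) :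
    ‖convFun f g u‖ ≤ ∑' p : Fiber u, ‖f p.1.1 * g p.1.2‖ :=
  norm_tsum_le_tsum_norm (summable_fiber f g u)

theorem summable_convFun (f g : EllOne 𝕜 S) : Summable fun u => ‖convFun f g u‖ :=
  (hasSum_fiberwise f g).summable.of_nonneg_of_le (fun _ => norm_nonneg _) (norm_convFun_le f g)

instance : Mul (EllOne 𝕜 S) := ⟨fun f g => mk (convFun f g) (summable_convFun f g)⟩

theorem mul_apply (f g : EllOne 𝕜 S) (u : S) :
    (f * g) u = ∑' p : Fiber u, f p.1.1 * g p.1.2 := rfl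

instance : One (EllOne 𝕜 S) := ⟨basisVec 1⟩

theorem norm_mul_le' (f g : EllOne 𝕜 S) : ‖f * g‖ ≤ ‖f‖ * ‖g‖ := by
  refine norm_le_of_tsum_le _ ?_
  rw [← (hasSum_fiberwise f g).tsum_eq]
  exact (summable_convFun f g).tsum_le_tsum (norm_convFun_le f g) (hasSum_fiberwise f g).summable

theorem add_mul' (f f' g : EllOne 𝕜 S) : (f + f') * g = f * g + f' * g := by
  refine ext' fun u => ?_
  change ∑' p : Fiber u, (f p.1.1 + f' p.1.1) * g p.1.2 =
    ∑' p : Fiber u, f p.1.1 * g p.1.2 + ∑' p : Fiber u, f' p.1.1 * g p.1.2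
  rw [← (summable_fiber f g u).of_norm.tsum_add (summable_fiber f' g u).of_norm]
  simp only [add_mul]

theorem mul_add' (f g g' : EllOne 𝕜 S) : f * (g + g') = f * g + f * g' := by
  refine ext' fun u => ?_
  change ∑' p : Fiber u, f p.1.1 * (g p.1.2 + g' p.1.2) =
    ∑' p : Fiber u, f p.1.1 * g p.1.2 + ∑' p : Fiber u, f p.1.1 * g' p.1.2
  rw [← (summable_fiber f g u).of_norm.tsum_add (summable_fiber f g' u).of_norm]
  simp only [mul_add]

theorem smul_mul' (c : 𝕜) (f g : EllOne 𝕜 S) : (c • f) * g = c • (f * g) := by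
  refine ext' fun u => ?_
  change ∑' p : Fiber u, (c * f p.1.1) * g p.1.2 = c * ∑' p : Fiber u, f p.1.1 * g p.1.2
  rw [← tsum_mul_left]
  simp only [mul_assoc]

theorem mul_smul' (c : 𝕜) (f g : EllOne 𝕜 S) : f * (c • g) = c • (f * g) := by
  refine ext' fun u => ?_
  change ∑' p : Fiber u, f p.1.1 * (c * g p.1.2) = c * ∑' p : Fiber u, f p.1.1 * g p.1.2
  rw [← tsum_mul_left]
  simp only [mul_left_comm]

/-- The convolution product as a continuous bilinear map. -/
def mulCLM : EllOne 𝕜 S →L[𝕜] EllOne 𝕜 S →L[𝕜] EllOne 𝕜 S :=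
  LinearMap.mkContinuous₂ (LinearMap.mk₂ 𝕜 (fun f g => f * g) add_mul' smul_mul' mul_add' mul_smul')
    1 (fun f g => by simpa using norm_mul_le' f g)

theorem mulCLM_apply (f g : EllOne 𝕜 S) : mulCLM f g = f * g := rfl

/-- The rule `e_s * e_t = e_{s t}`. -/
theorem basisVec_mul (s t : S) :
    (basisVec s * basisVec t : EllOne 𝕜 S) = basisVec (s * t) := by
  classical
  refine ext' fun u => ?_
  rw [mul_apply, basisVec_apply]
  simp only [basisVec_apply]
  by_cases hu : u = s * t
  · rw [if_pos hu, tsum_eq_single (⟨(s, t), hu.symm⟩ : Fiber u)]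
    · simp
    · rintro ⟨⟨a, b⟩, hab⟩ hne
      have : ¬ (a = s ∧ b = t) := fun h => hne (Subtype.ext (Prod.ext h.1 h.2))
      by_cases ha : a = s <;> by_cases hb : b = t <;> simp_all
  · rw [if_neg hu]
    convert tsum_zero with p
    obtain ⟨⟨a, b⟩, hab⟩ := p
    have : ¬ (a = s ∧ b = t) := by rintro ⟨rfl, rfl⟩; exact hu hab.symm
    by_cases ha : a = s <;> by_cases hb : b = t <;> simp_all

theorem one_mul' (f : EllOne 𝕜 S) : 1 * f = f := by
  have : mulCLM (1 : EllOne 𝕜 S) = ContinuousLinearMap.id 𝕜 _ := clm_ext fun s => by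
    change basisVec 1 * basisVec s = basisVec s
    rw [basisVec_mul, one_mul]
  exact congrArg (fun T => T f) this

theorem mul_one' (f : EllOne 𝕜 S) : f * 1 = f := by
  have : mulCLM.flip (1 : EllOne 𝕜 S) = ContinuousLinearMap.id 𝕜 _ := clm_ext fun s => by
    change basisVec s * basisVec 1 = basisVec s
    rw [basisVec_mul, mul_one]
  exact congrArg (fun T => T f) this

theorem mul_assoc' (f g h : EllOne 𝕜 S) : f * g * h = f * (g * h) := by
  have h1 (s t : S) (h : EllOne 𝕜 S) :
      basisVec s * basisVec t * h = basisVec s * (basisVec t * h) := by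
    have : mulCLM (basisVec s * basisVec t : EllOne 𝕜 S) =
        (mulCLM (basisVec s)).comp (mulCLM (basisVec t)) := clm_ext fun r => by
      change basisVec s * basisVec t * basisVec r = basisVec s * (basisVec t * basisVec r)
      simp only [basisVec_mul, mul_assoc]
    exact congrArg (fun T => T h) this
  have h2 (s : S) (g h : EllOne 𝕜 S) : basisVec s * g * h = basisVec s * (g * h) := by
    have : (mulCLM.flip h).comp (mulCLM (basisVec s : EllOne 𝕜 S)) =
        (mulCLM (basisVec s)).comp (mulCLM.flip h) := clm_ext fun t => h1 s t h
    exact congrArg (fun T => T g) this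
  have : (mulCLM.flip h).comp (mulCLM.flip g) = (mulCLM.flip (g * h) : EllOne 𝕜 S →L[𝕜] _) :=
    clm_ext fun s => h2 s g h
  exact congrArg (fun T => T f) this

instance : NormedRing (EllOne 𝕜 S) where
  __ := (inferInstance : NormedAddCommGroup (EllOne 𝕜 S))
  mul := (· * ·)
  one := 1
  left_distrib := mul_add'
  right_distrib := add_mul'
  zero_mul f := by simpa using smul_mul' (0 : 𝕜) f f
  mul_zero f := by simpa using mul_smul' (0 : 𝕜) f f
  mul_assoc := mul_assoc'
  one_mul := one_mul'
  mul_one := mul_one'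
  norm_mul_le := norm_mul_le'

instance : NormedAlgebra 𝕜 (EllOne 𝕜 S) where
  __ := Algebra.ofModule smul_mul' mul_smul'
  norm_smul_le := norm_smul_le

end Convolution

end EllOne

/-- A unital Banach algebra over `𝕜`: a complete normed associative algebra with a unit. -/
structure UnitalBanachAlgebra (𝕜 : Type) [RCLike 𝕜] where
  carrier : Type u
  [normedRing : NormedRing carrier]
  [normedAlgebra : NormedAlgebra 𝕜 carrier]
  [completeSpace : CompleteSpace carrier]

namespace UnitalBanachAlgebra

attribute [instance] normedRing normedAlgebra completeSpace

/-- Two unital Banach algebras of density `κ` are isomorphic when there is an algebra isomorphism between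
them that is a homeomorphism. -/
def isoSetoid (𝕜 : Type) [RCLike 𝕜] (κ : Cardinal.{u}) :
    Setoid {A : UnitalBanachAlgebra.{u} 𝕜 // topDensity A.carrier = κ} where
  r A B := Nonempty (A.1.carrier ≃A[𝕜] B.1.carrier)
  iseqv :=
    { refl := fun _ => ⟨ContinuousAlgEquiv.refl 𝕜 _⟩
      symm := fun ⟨e⟩ => ⟨e.symm⟩
      trans := fun ⟨e⟩ ⟨f⟩ => ⟨e.trans f⟩ }

/-- The isomorphism types of unital Banach algebras of density `κ`. -/
def IsoTypes (𝕜 : Type) [RCLike 𝕜] (κ : Cardinal.{u}) : Type (u + 1) :=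
  Quotient (isoSetoid 𝕜 κ)

end UnitalBanachAlgebra

end

/-! ### Successive approximation and extension of bounded maps to `ℓ₁`. -/

noncomputable section

/-! Quotients: scale a dense family of `A` into the unit ball, extend it multiplicatively to the
free monoid and then linearly to `ℓ₁`. Multiples of unit vectors hit every point up to half its
norm, so the map is onto (`EllOne.exists_surjective`), and the open mapping theorem identifies `A`
with the quotient by its kernel.

Upper bound: an isomorphism type is thus determined by a closed subset of a metric space of density
`κ`, and there are at most `2 ^ κ` of these (`mk_closeds_le`).

Lower bound: a relation `R` on a set of size `κ` gives the algebra `ℓ₁(PathMonoid R)`. Vertices `v`,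
`w` yield characters, and `R v w` holds exactly when the one-dimensional bimodule with these two
actions admits a non-inner derivation (`PathMonoid.inner_or_related`). If every vertex has an
outgoing arrow, the algebra therefore determines `R` up to isomorphism. Adding loops on a set `X` to
a well-order of type `κ.ord` gives `2 ^ κ` such relations, pairwise non-isomorphic because
well-orders are rigid. -/

theorem ContinuousLinearMap.surjective_of_approx {𝕜 E F : Type*} [RCLike 𝕜]
    [NormedAddCommGroup E] [NormedSpace 𝕜 E] [CompleteSpace E]
    [NormedAddCommGroup F] [NormedSpace 𝕜 F] (T : E →L[𝕜] F) (C : ℝ)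
    (h : ∀ y, ∃ x, ‖x‖ ≤ C * ‖y‖ ∧ ‖y - T x‖ ≤ 1 / 2 * ‖y‖) : Function.Surjective T := by
  choose g hg hT using h
  intro y
  set r : F → F := fun z => z - T (g z) with hr
  have hC (n : ℕ) : ‖r^[n] y‖ ≤ (1 / 2) ^ n * ‖y‖ := by
    induction n with
    | zero => simp
    | succ n ih =>
      rw [Function.iterate_succ_apply', pow_succ']
      have := hT (r^[n] y)
      simp only [hr] at this ih ⊢
      linarith
  -- The residuals halve at each step, so the corrections are dominated by a geometric series; `C`
  -- carries no sign assumption.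
  have hgeo : Summable fun n : ℕ => |C| * ((1 / 2 : ℝ) ^ n * ‖y‖) :=
    ((summable_geometric_of_lt_one (by norm_num) (by norm_num)).mul_right _).mul_left _
  have hsum : Summable fun n => g (r^[n] y) := by
    refine Summable.of_norm_bounded hgeo fun n => (hg _).trans ?_
    exact mul_le_mul (le_abs_self C) (hC n) (norm_nonneg _) (abs_nonneg _)
  have hpart (n : ℕ) : ∑ i ∈ Finset.range n, T (g (r^[i] y)) = y - r^[n] y := by
    induction n with
    | zero => simp
    | succ n ih =>
      rw [Finset.sum_range_succ, ih, Function.iterate_succ_apply']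
      simp only [hr]
      abel
  have hlim : Filter.Tendsto (fun n => r^[n] y) Filter.atTop (nhds 0) := by
    refine squeeze_zero_norm hC ?_
    simpa using (tendsto_pow_atTop_nhds_zero_of_lt_one (r := (1 / 2 : ℝ))
      (by norm_num) (by norm_num)).mul_const ‖y‖
  refine ⟨∑' n, g (r^[n] y), ?_⟩
  have h1 := (hsum.hasSum.mapL T).tendsto_sum_nat
  simp only [hpart] at h1
  have h2 := (tendsto_const_nhds (x := y)).sub hlim
  rw [sub_zero] at h2
  exact tendsto_nhds_unique h1 h2

namespace EllOne

section Lift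

variable {𝕜 S : Type*} [RCLike 𝕜]

theorem hasSum_basisVec (f : EllOne 𝕜 S) :
    HasSum (fun s => f s • (basisVec s : EllOne 𝕜 S)) f := by
  classical
  have e : (fun s => f s • (basisVec s : EllOne 𝕜 S)) =
      fun s => (lp.single 1 s (f s) : lp (fun _ : S => 𝕜) 1) := by
    funext s
    refine ext' fun t => ?_
    change f s * (basisVec s : EllOne 𝕜 S) t = (Pi.single s (f s) : S → 𝕜) t
    rw [basisVec_apply, Pi.single_apply]
    split_ifs <;> simp
  rw [e]
  exact lp.hasSum_single (p := 1) (by simp) (f : lp (fun _ : S => 𝕜) 1)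

theorem norm_basisVec (s : S) : ‖(basisVec s : EllOne 𝕜 S)‖ = 1 := by
  rw [← (hasSum_norm _).tsum_eq, tsum_eq_single s]
  · simp [basisVec_apply]
  · intro t ht
    simp [basisVec_apply, ht]

theorem norm_apply_le (f : EllOne 𝕜 S) (s : S) : ‖f s‖ ≤ ‖f‖ := by
  rw [← (hasSum_norm f).tsum_eq]
  exact (hasSum_norm f).summable.le_tsum s fun _ _ => norm_nonneg _

variable {F : Type*} [NormedAddCommGroup F] [NormedSpace 𝕜 F]

theorem summable_norm_smul {φ : S → F} {C : ℝ} (hφ : ∀ s, ‖φ s‖ ≤ C) (f : EllOne 𝕜 S) :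
    Summable fun s => ‖f s • φ s‖ := by
  refine ((hasSum_norm f).summable.mul_right C).of_nonneg_of_le (fun _ => norm_nonneg _) fun s => ?_
  rw [norm_smul]
  exact mul_le_mul_of_nonneg_left (hφ s) (norm_nonneg _)

variable [CompleteSpace F]

/-- The continuous linear extension of a bounded function on `S` to `ℓ₁(S)`. -/
def lift (φ : S → F) (C : ℝ) (hφ : ∀ s, ‖φ s‖ ≤ C) : EllOne 𝕜 S →L[𝕜] F :=
  LinearMap.mkContinuous
    { toFun := fun f => ∑' s, f s • φ s
      map_add' := fun f g => by
        rw [← (summable_norm_smul hφ f).of_norm.tsum_add (summable_norm_smul hφ g).of_norm]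
        exact tsum_congr fun s => add_smul (f s) (g s) (φ s)
      map_smul' := fun c f => by
        rw [RingHom.id_apply, ← (summable_norm_smul hφ f).of_norm.tsum_const_smul]
        exact tsum_congr fun s => mul_smul c (f s) (φ s) }
    C fun f => by
      refine (norm_tsum_le_tsum_norm (summable_norm_smul hφ f)).trans ?_
      rw [mul_comm, ← (hasSum_norm f).tsum_eq, ← tsum_mul_right]
      refine (summable_norm_smul hφ f).tsum_le_tsum (fun s => ?_)
        ((hasSum_norm f).summable.mul_right C)
      rw [norm_smul]
      exact mul_le_mul_of_nonneg_left (hφ s) (norm_nonneg _)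

@[simp]
theorem lift_basisVec (φ : S → F) (C : ℝ) (hφ : ∀ s, ‖φ s‖ ≤ C) (s : S) :
    lift φ C hφ (basisVec s : EllOne 𝕜 S) = φ s := by
  change ∑' t, (basisVec s : EllOne 𝕜 S) t • φ t = φ s
  rw [tsum_eq_single s]
  · simp [basisVec_apply]
  · intro t ht
    simp [basisVec_apply, ht]

theorem clm_ext₂ {F : Type*} [NormedAddCommGroup F] [NormedSpace 𝕜 F]
    {T U : EllOne 𝕜 S →L[𝕜] EllOne 𝕜 S →L[𝕜] F}
    (h : ∀ s t, T (basisVec s) (basisVec t) = U (basisVec s) (basisVec t)) : T = U :=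
  clm_ext fun s => clm_ext fun t => h s t

end Lift

section AlgLift

variable {𝕜 S A : Type*} [RCLike 𝕜] [Monoid S] [NormedRing A] [NormedAlgebra 𝕜 A]
  [CompleteSpace A]

/-- The extension of a bounded monoid homomorphism to a continuous algebra homomorphism. -/
def liftAlgHom (φ : S →* A) (C : ℝ) (hφ : ∀ s, ‖φ s‖ ≤ C) : EllOne 𝕜 S →A[𝕜] A where
  toAlgHom := AlgHom.ofLinearMap (lift φ C hφ : EllOne 𝕜 S →L[𝕜] A).toLinearMap
    (by
      change lift φ C hφ (basisVec 1 : EllOne 𝕜 S) = 1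
      simp)
    (by
      intro f g
      set T : EllOne 𝕜 S →L[𝕜] A := lift φ C hφ with hT
      have : (ContinuousLinearMap.compL 𝕜 (EllOne 𝕜 S) (EllOne 𝕜 S) A T).comp mulCLM =
          (ContinuousLinearMap.mul 𝕜 A).bilinearComp T T := clm_ext₂ fun s t => by
        change T (basisVec s * basisVec t) = T (basisVec s) * T (basisVec t)
        rw [basisVec_mul]
        simp [hT]
      exact congrArg (fun B => B f g) this)
  cont := (lift φ C hφ).continuous

@[simp]
theorem liftAlgHom_basisVec (φ : S →* A) (C : ℝ) (hφ : ∀ s, ‖φ s‖ ≤ C) (s : S) :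
    liftAlgHom φ C hφ (basisVec s : EllOne 𝕜 S) = φ s :=
  lift_basisVec φ C hφ s

end AlgLift

end EllOne

/-! ### Banach algebras as quotients of `ℓ₁` of a free monoid. -/

theorem exists_dense_mk_eq_topDensity (X : Type u) [TopologicalSpace X] :
    ∃ s : Set X, Dense s ∧ #s = topDensity X :=
  csInf_mem (s := {c : Cardinal.{u} | ∃ s : Set X, Dense s ∧ #s = c})
    ⟨_, Set.univ, dense_univ, rfl⟩

theorem topDensity_le_mk {X : Type u} [TopologicalSpace X] {s : Set X} (hs : Dense s) :
    topDensity X ≤ #s :=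
  csInf_le' ⟨s, hs, rfl⟩

theorem le_topDensity {X : Type u} [TopologicalSpace X] {c : Cardinal.{u}}
    (h : ∀ s : Set X, Dense s → c ≤ #s) : c ≤ topDensity X := by
  obtain ⟨s, hs, e⟩ := exists_dense_mk_eq_topDensity X
  exact e ▸ h s hs

/-- Every unital Banach algebra with a dense subset of cardinality at most `#ι` is the image of
`ℓ₁` of the free monoid on `ι` under a continuous algebra homomorphism. -/
theorem EllOne.exists_surjective {𝕜 A ι : Type*} [RCLike 𝕜] [NormedRing A] [NormedAlgebra 𝕜 A]
    [CompleteSpace A] (d : ι → A) (hd : DenseRange d) :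
    ∃ T : EllOne 𝕜 (FreeMonoid ι) →A[𝕜] A, Function.Surjective T := by
  -- If `d i = 0`, the convention `0⁻¹ = 0` gives `w i = 0`.
  set w : ι → A := fun i => ((‖d i‖ : 𝕜))⁻¹ • d i with hw
  have hw1 (i : ι) : ‖w i‖ ≤ 1 := by
    simp only [hw, norm_smul, norm_inv, RCLike.norm_ofReal, abs_norm]
    exact inv_mul_le_one
  have hwd (i : ι) : (‖d i‖ : 𝕜) • w i = d i := by
    rcases eq_or_ne (d i) 0 with h | h
    · simp [hw, h]
    · simp only [hw]
      rw [smul_smul, mul_inv_cancel₀, one_smul]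
      simpa using h
  -- The empty word maps to `1`, whose norm is not assumed to be `1`.
  have hbd (s : FreeMonoid ι) : ‖FreeMonoid.lift w s‖ ≤ max 1 ‖(1 : A)‖ := by
    induction s using FreeMonoid.inductionOn' with
    | one => simp
    | of_mul i s ih =>
      rw [map_mul, FreeMonoid.lift_eval_of]
      refine (norm_mul_le _ _).trans ?_
      refine (mul_le_mul_of_nonneg_right (hw1 i) (norm_nonneg _)).trans ?_
      rwa [one_mul]
  set T : EllOne 𝕜 (FreeMonoid ι) →A[𝕜] A := liftAlgHom (FreeMonoid.lift w) _ hbd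
  refine ⟨T, ContinuousLinearMap.surjective_of_approx
    (EllOne.lift (FreeMonoid.lift w) _ hbd : EllOne 𝕜 (FreeMonoid ι) →L[𝕜] A) 2 fun y => ?_⟩
  rcases eq_or_ne y 0 with rfl | hy
  · exact ⟨0, by simp⟩
  obtain ⟨i, hi⟩ := hd.exists_dist_lt y (ε := 1 / 2 * ‖y‖) (by positivity)
  rw [dist_eq_norm] at hi
  refine ⟨(‖d i‖ : 𝕜) • basisVec (FreeMonoid.of i), ?_, ?_⟩
  · rw [norm_smul, norm_basisVec, RCLike.norm_ofReal, abs_norm]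
    have := norm_le_norm_add_norm_sub y (d i)
    have := norm_nonneg y
    linarith
  · rw [map_smul, lift_basisVec, FreeMonoid.lift_eval_of, hwd]
    exact hi.le

/-- The quotient of a Banach algebra by the kernel of a surjective continuous homomorphism. -/
theorem ContinuousAlgHom.nonempty_quotient_ker_equiv {𝕜 A B : Type*} [RCLike 𝕜]
    [NormedRing A] [NormedAlgebra 𝕜 A] [CompleteSpace A]
    [NormedRing B] [NormedAlgebra 𝕜 B] [CompleteSpace B] (T : A →A[𝕜] B)
    (hT : Function.Surjective T) :
    Nonempty ((A ⧸ RingHom.ker (T : A →ₐ[𝕜] B)) ≃A[𝕜] B) := by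
  have hopen : IsOpenMap T := ContinuousLinearMap.isOpenMap T.toContinuousLinearMap hT
  have hT' : Function.Surjective (T : A →ₐ[𝕜] B) := hT
  let e := Ideal.quotientKerAlgEquivOfSurjective hT'
  have he (a : A) : e (Ideal.Quotient.mk _ a) = T a := rfl
  have hcont : Continuous e := by
    refine continuous_quot_lift _ T.cont
  -- Openness of `T` passes to `e`, since `e` and `T` have the same images of saturated open sets.
  have heopen : IsOpenMap e := by
    intro U hU
    have : e '' U = T '' ((Ideal.Quotient.mk (RingHom.ker (T : A →ₐ[𝕜] B))) ⁻¹' U) := by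
      ext b
      constructor
      · rintro ⟨q, hq, rfl⟩
        obtain ⟨a, rfl⟩ := Ideal.Quotient.mk_surjective q
        exact ⟨a, hq, (he a).symm⟩
      · rintro ⟨a, ha, rfl⟩
        exact ⟨_, ha, he a⟩
    rw [this]
    exact hopen _ (hU.preimage continuous_quot_mk)
  exact ⟨{ toAlgEquiv := e
           continuous_toFun := hcont
           continuous_invFun := (e.toEquiv.toHomeomorphOfContinuousOpen hcont heopen).symm.continuous }⟩

theorem exists_ideal_quotient_equiv {𝕜 : Type} [RCLike 𝕜] {κ : Cardinal.{u}} (A : Type u)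
    [NormedRing A] [NormedAlgebra 𝕜 A] [CompleteSpace A] (hA : topDensity A = κ) :
    ∃ (I : Ideal (EllOne 𝕜 (FreeMonoid κ.out))) (_ : I.IsTwoSided),
      IsClosed (I : Set (EllOne 𝕜 (FreeMonoid κ.out))) ∧
        Nonempty ((EllOne 𝕜 (FreeMonoid κ.out) ⧸ I) ≃A[𝕜] A) := by
  obtain ⟨s, hs, hsc⟩ := exists_dense_mk_eq_topDensity A
  obtain ⟨e⟩ : Nonempty (κ.out ≃ s) := Cardinal.eq.mp (by rw [mk_out, hsc, hA])
  have hd : DenseRange fun i => (e i : A) := by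
    have : Set.range (fun i => (e i : A)) = s := by
      rw [show (fun i => (e i : A)) = Subtype.val ∘ e from rfl, Set.range_comp]
      simp
    rw [DenseRange, this]
    exact hs
  obtain ⟨T, hT⟩ := EllOne.exists_surjective (𝕜 := 𝕜) _ hd
  refine ⟨RingHom.ker (T : EllOne 𝕜 (FreeMonoid κ.out) →ₐ[𝕜] A), inferInstance, ?_,
    T.nonempty_quotient_ker_equiv hT⟩
  exact isClosed_singleton.preimage T.cont

/-! ### The density of `ℓ₁(S)` and the upper bound. -/

namespace EllOne

variable {𝕜 : Type} {S : Type u} [RCLike 𝕜]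

/-- Finite combinations of basis vectors with coefficients from a dense sequence are dense. -/
theorem exists_dense_mk_le [Infinite S] :
    ∃ D : Set (EllOne 𝕜 S), Dense D ∧ #D ≤ #S := by
  obtain ⟨q, hq⟩ := TopologicalSpace.exists_dense_seq 𝕜
  set c : S × ℕ → EllOne 𝕜 S := fun p => q p.2 • basisVec p.1 with hc
  -- As an image of the lists over `S × ℕ`, this submonoid has at most `#S` elements.
  let G : AddSubmonoid (EllOne 𝕜 S) := AddMonoidHom.mrange (FreeAddMonoid.lift c)
  refine ⟨G, ?_, ?_⟩
  · have hmem (s : S) (a : 𝕜) : a • (basisVec s : EllOne 𝕜 S) ∈ G.topologicalClosure := by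
      have hcont : Continuous fun a : 𝕜 => a • (basisVec s : EllOne 𝕜 S) := by fun_prop
      have hcl := G.isClosed_topologicalClosure.preimage hcont
      have hsub : Set.range q ⊆
          (fun a : 𝕜 => a • (basisVec s : EllOne 𝕜 S)) ⁻¹' G.topologicalClosure := by
        rintro _ ⟨n, rfl⟩
        exact G.le_topologicalClosure ⟨FreeAddMonoid.of (s, n), by simp [hc]⟩
      exact hcl.closure_subset_iff.mpr hsub (hq a)
    intro f
    change f ∈ G.topologicalClosure
    exact G.isClosed_topologicalClosure.mem_of_tendsto (hasSum_basisVec f)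
      (Filter.Eventually.of_forall fun t => sum_mem fun s _ => hmem s _)
  · calc #G ≤ #(List (S × ℕ)) := mk_range_le (f := (FreeAddMonoid.lift c : _ → EllOne 𝕜 S))
      _ = #S := by
        rw [mk_list_eq_mk, mk_prod, lift_uzero, mk_nat, lift_aleph0]
        exact mul_aleph0_eq (aleph0_le_mk S)

/-- For the lower bound, distinct unit vectors are at distance at least `1`, so points of a dense
set within `1 / 2` of them are distinct. -/
theorem topDensity_eq [Infinite S] : topDensity (EllOne 𝕜 S) = #S := by
  apply le_antisymm
  · obtain ⟨D, hD, hDS⟩ := exists_dense_mk_le (𝕜 := 𝕜) (S := S)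
    exact (topDensity_le_mk hD).trans hDS
  · refine le_topDensity fun D hD => ?_
    have hnear (s : S) : ∃ d ∈ D, dist (basisVec s : EllOne 𝕜 S) d < 1 / 2 :=
      hD.exists_dist_lt _ (by norm_num)
    choose d hdD hd using hnear
    refine mk_le_of_injective (f := fun s => (⟨d s, hdD s⟩ : D)) fun s t hst => ?_
    have hdst : d s = d t := congrArg Subtype.val hst
    by_contra hne
    have h1 : dist (basisVec s : EllOne 𝕜 S) (basisVec t) < 1 := by
      have := dist_triangle_right (basisVec s : EllOne 𝕜 S) (basisVec t) (d s)
      have h2 := hd s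
      have h3 := hd t
      rw [← hdst] at h3
      linarith
    have h2 := norm_apply_le (basisVec s - basisVec t : EllOne 𝕜 S) s
    have h3 : (basisVec s - basisVec t : EllOne 𝕜 S) s = 1 := by
      change (basisVec s : EllOne 𝕜 S) s - (basisVec t : EllOne 𝕜 S) s = 1
      simp [basisVec_apply, hne]
    rw [h3, norm_one, ← dist_eq_norm] at h2
    linarith

end EllOne

/-- A metric space with an infinite dense set `D` has at most `2 ^ #D` closed subsets. -/
theorem mk_closeds_le {X : Type u} [PseudoMetricSpace X] {D : Set X} (hD : Dense D)
    {κ : Cardinal.{u}} (hκ : ℵ₀ ≤ κ) (hDκ : #D ≤ κ) :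
    #{C : Set X // IsClosed C} ≤ 2 ^ κ := by
  -- A closed set is coded by the balls of radius `1 / (n + 1)` around points of `D` that meet it.
  have hinj : Function.Injective fun C : {C : Set X // IsClosed C} =>
      {p : D × ℕ | ∃ c ∈ C.1, dist (p.1 : X) c < 1 / (p.2 + 1 : ℝ)} := by
    have key {C C' : {C : Set X // IsClosed C}}
        (h : {p : D × ℕ | ∃ c ∈ C.1, dist (p.1 : X) c < 1 / (p.2 + 1 : ℝ)} =
          {p : D × ℕ | ∃ c ∈ C'.1, dist (p.1 : X) c < 1 / (p.2 + 1 : ℝ)}) : C.1 ⊆ C'.1 := by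
      intro x hx
      rw [← C'.2.closure_eq]
      refine Metric.mem_closure_iff.mpr fun ε hε => ?_
      obtain ⟨n, hn⟩ := exists_nat_one_div_lt (half_pos hε)
      obtain ⟨d, hdD, hd⟩ := hD.exists_dist_lt x (ε := 1 / (n + 1 : ℝ)) (by positivity)
      have hmem : ((⟨d, hdD⟩, n) : D × ℕ) ∈
          {p : D × ℕ | ∃ c ∈ C.1, dist (p.1 : X) c < 1 / (p.2 + 1 : ℝ)} :=
        ⟨x, hx, by rwa [dist_comm]⟩
      rw [h] at hmem
      obtain ⟨c, hc, hcd⟩ := hmem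
      refine ⟨c, hc, ?_⟩
      have := dist_triangle x d c
      dsimp only at hcd
      linarith
    intro C C' h
    exact Subtype.ext ((key h).antisymm (key h.symm))
  refine (mk_le_of_injective hinj).trans ?_
  rw [mk_set, mk_prod, lift_uzero, mk_nat, lift_aleph0]
  refine power_le_power_left two_ne_zero ?_
  exact (mul_le_mul' hDκ hκ).trans (mul_eq_self hκ).le

theorem Ideal.nonempty_quotient_equiv_of_eq {𝕜 A : Type*} [RCLike 𝕜] [NormedRing A]
    [NormedAlgebra 𝕜 A] {I J : Ideal A} [I.IsTwoSided] [J.IsTwoSided] (h : I = J) :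
    Nonempty ((A ⧸ I) ≃A[𝕜] (A ⧸ J)) := by
  subst h
  exact ⟨ContinuousAlgEquiv.refl 𝕜 _⟩

namespace UnitalBanachAlgebra

theorem mk_isoTypes_le (𝕜 : Type) [RCLike 𝕜] {κ : Cardinal.{u}} (hκ : ℵ₀ ≤ κ) :
    #(IsoTypes.{u} 𝕜 κ) ≤ Cardinal.lift.{u + 1} ((2 : Cardinal.{u}) ^ κ) := by
  have : Infinite κ.out := infinite_iff.mpr (by rwa [mk_out])
  have hex (q : IsoTypes.{u} 𝕜 κ) := exists_ideal_quotient_equiv (𝕜 := 𝕜) q.out.1.carrier q.out.2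
  choose I hI hclosed hiso using hex
  have hinj : Function.Injective fun q : IsoTypes.{u} 𝕜 κ =>
      (⟨I q, hclosed q⟩ : {C : Set (EllOne 𝕜 (FreeMonoid κ.out)) // IsClosed C}) := by
    intro q r h
    have hIqr : I q = I r := SetLike.coe_injective (congrArg Subtype.val h)
    obtain ⟨e⟩ := hiso q
    obtain ⟨f⟩ := hiso r
    rw [← q.out_eq, ← r.out_eq]
    refine Quotient.sound ?_
    obtain ⟨g⟩ := Ideal.nonempty_quotient_equiv_of_eq (𝕜 := 𝕜) hIqr
    exact ⟨e.symm.trans (g.trans f)⟩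
  have h1 := lift_mk_le_lift_mk_of_injective hinj
  obtain ⟨D, hD, hDS⟩ := EllOne.exists_dense_mk_le (𝕜 := 𝕜) (S := FreeMonoid κ.out)
  have h2 : #(FreeMonoid κ.out) = κ := (mk_list_eq_mk _).trans (mk_out κ)
  have h3 := mk_closeds_le hD hκ (hDS.trans h2.le)
  have h4 := h1.trans (lift_le.mpr h3)
  rwa [lift_id'.{u, u + 1}] at h4

end UnitalBanachAlgebra

/-! ### The path monoid, its characters and its derivations. -/

/-- The path monoid, with zero and an adjoined unit, of a relation `R` on `V`: paths of length at
most one, the product being concatenation where that is again such a path, and zero elsewhere. -/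
inductive PathMonoid {V : Type u} (R : V → V → Prop) : Type u
  | one : PathMonoid R
  | zero : PathMonoid R
  | vertex (v : V) : PathMonoid R
  | arrow (v w : V) (h : R v w) : PathMonoid R

namespace PathMonoid

variable {V : Type u} {R : V → V → Prop}

open Classical in
/-- Concatenation of paths. -/
protected def mul : PathMonoid R → PathMonoid R → PathMonoid R
  | one, x => x
  | x, one => x
  | vertex v, vertex w => if v = w then vertex v else zero
  | vertex v, arrow a b h => if v = a then arrow a b h else zero
  | arrow a b h, vertex v => if b = v then arrow a b h else zero
  | _, _ => zero

instance : Mul (PathMonoid R) := ⟨PathMonoid.mul⟩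
instance : One (PathMonoid R) := ⟨one⟩
instance : Zero (PathMonoid R) := ⟨zero⟩

theorem one_def : (one : PathMonoid R) = 1 := rfl
theorem zero_def : (zero : PathMonoid R) = 0 := rfl

protected theorem one_mul' (x : PathMonoid R) : 1 * x = x := by cases x <;> rfl
protected theorem mul_one' (x : PathMonoid R) : x * 1 = x := by cases x <;> rfl
protected theorem zero_mul' (x : PathMonoid R) : 0 * x = 0 := by cases x <;> rfl
protected theorem mul_zero' (x : PathMonoid R) : x * 0 = 0 := by cases x <;> rfl

open Classical in
theorem vertex_mul_vertex (v w : V) :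
    (vertex v * vertex w : PathMonoid R) = if v = w then vertex v else 0 := rfl
open Classical in
theorem vertex_mul_arrow (v a b : V) (h : R a b) :
    vertex v * arrow a b h = if v = a then arrow a b h else 0 := rfl
open Classical in
theorem arrow_mul_vertex (v a b : V) (h : R a b) :
    arrow a b h * vertex v = if b = v then arrow a b h else 0 := rfl
theorem arrow_mul_arrow (a b c d : V) (h : R a b) (k : R c d) :
    arrow a b h * arrow c d k = 0 := rfl

protected theorem mul_assoc' (x y z : PathMonoid R) : x * y * z = x * (y * z) := by
  cases x <;> cases y <;> cases z <;>
    simp only [one_def, zero_def, PathMonoid.one_mul', PathMonoid.mul_one', PathMonoid.zero_mul',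
      PathMonoid.mul_zero', vertex_mul_vertex, vertex_mul_arrow, arrow_mul_vertex,
      arrow_mul_arrow] <;>
    grind [vertex_mul_vertex, vertex_mul_arrow, arrow_mul_vertex, arrow_mul_arrow,
      PathMonoid.zero_mul', PathMonoid.mul_zero']

instance : MonoidWithZero (PathMonoid R) where
  one_mul := PathMonoid.one_mul'
  mul_one := PathMonoid.mul_one'
  mul_assoc := PathMonoid.mul_assoc'
  zero_mul := PathMonoid.zero_mul'
  mul_zero := PathMonoid.mul_zero'

theorem vertex_mul_self (v : V) : (vertex v * vertex v : PathMonoid R) = vertex v := by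
  simp [vertex_mul_vertex]

theorem mk_eq [Infinite V] : #(PathMonoid R) = #V := by
  apply le_antisymm
  · have hinj : Function.Injective (fun x : PathMonoid R => match x with
        | one => (Sum.inl true : Bool ⊕ (V ⊕ V × V))
        | zero => Sum.inl false
        | vertex v => Sum.inr (Sum.inl v)
        | arrow v w _ => Sum.inr (Sum.inr (v, w))) := by
      intro x y h
      cases x <;> cases y <;> simp_all
    have h1 := lift_mk_le_lift_mk_of_injective hinj
    refine (by simpa using h1 : #(PathMonoid R) ≤ _).trans ?_
    have hV := aleph0_le_mk V
    simpa [mul_eq_self hV, add_eq_self hV] using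
      (add_eq_right hV ((natCast_lt_aleph0 (n := 2)).le.trans hV)).le
  · exact mk_le_of_injective (f := vertex) fun v w h => by simpa using h

end PathMonoid

namespace PathMonoid

variable {V : Type u} {R : V → V → Prop} {𝕜 : Type*} [Field 𝕜]

open Classical in
/-- The character of the path monoid supported at the vertex `v`. -/
def character (𝕜 : Type*) [Field 𝕜] (R : V → V → Prop) (v : V) : PathMonoid R →* 𝕜 where
  toFun
    | one => 1
    | vertex w => if w = v then 1 else 0
    | _ => 0
  map_one' := rfl
  map_mul' x y := by
    cases x <;> cases y <;>
      simp only [one_def, zero_def, one_mul, mul_one, zero_mul, mul_zero, vertex_mul_vertex,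
        vertex_mul_arrow, arrow_mul_vertex, arrow_mul_arrow] <;>
      simp only [← zero_def] <;> grind

theorem character_zero (v : V) : character 𝕜 R v 0 = 0 := rfl

open Classical in
theorem character_vertex (v w : V) :
    character 𝕜 R v (vertex w) = if w = v then 1 else 0 := rfl

theorem character_arrow (v a b : V) (h : R a b) : character 𝕜 R v (arrow a b h) = 0 := rfl

theorem map_arrow_eq_zero {φ : PathMonoid R →* 𝕜} (h0 : φ 0 = 0) {a b : V} (h : R a b) :
    φ (arrow a b h) = 0 := by
  have := map_mul φ (arrow a b h) (arrow a b h)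
  rw [arrow_mul_arrow, h0] at this
  exact mul_self_eq_zero.mp this.symm

theorem map_vertex_mul_of_ne {φ : PathMonoid R →* 𝕜} (h0 : φ 0 = 0) {v w : V} (h : v ≠ w) :
    φ (vertex v) * φ (vertex w) = 0 := by
  rw [← map_mul, vertex_mul_vertex, if_neg h, h0]

/-- Vertices are orthogonal idempotents and arrows square to zero, so one vertex of value `1` forces
all other values. -/
theorem eq_character {φ : PathMonoid R →* 𝕜} (h0 : φ 0 = 0) {v : V} (h : φ (vertex v) = 1) :
    φ = character 𝕜 R v := by
  ext x
  cases x with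
  | one => exact map_one φ
  | zero => exact h0
  | vertex w =>
    rw [character_vertex]
    split_ifs with hw
    · rw [hw, h]
    · simpa [h] using map_vertex_mul_of_ne h0 hw
  | arrow a b hab => rw [map_arrow_eq_zero h0, character_arrow]

theorem map_vertex_eq_zero_or_one (φ : PathMonoid R →* 𝕜) (v : V) :
    φ (vertex v) = 0 ∨ φ (vertex v) = 1 := by
  have := map_mul φ (vertex v) (vertex v)
  rw [vertex_mul_self] at this
  grind

/-- A derivation of the path monoid relative to two characters is inner unless the characters
are those of two related vertices. -/
theorem inner_or_related (φ ψ : PathMonoid R →* 𝕜) (d : PathMonoid R → 𝕜)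
    (hd : ∀ x y, d (x * y) = φ x * d y + d x * ψ y) :
    (∃ c, ∀ x, d x = c * (φ x - ψ x)) ∨
      ∃ v w, R v w ∧ φ = character 𝕜 R v ∧ ψ = character 𝕜 R w := by
  -- Expanding `d (z * x) = d (x * z)` gives `d x * (φ z - ψ z) = d z * (φ x - ψ x)`, so any such
  -- `z` with `φ z ≠ ψ z` makes `d` inner.
  have hcomm (z : PathMonoid R) (hz : φ z ≠ ψ z)
      (h : ∀ x, d (z * x) = d (x * z) ∨ d x = 0 ∧ φ x = ψ x) : ∃ c, ∀ x, d x = c * (φ x - ψ x) := by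
    refine ⟨d z / (φ z - ψ z), fun x => ?_⟩
    have hz' := sub_ne_zero.mpr hz
    rcases h x with h | ⟨h1, h2⟩
    · rw [hd, hd] at h
      field_simp
      linear_combination h
    · rw [h1, h2]
      ring
  by_cases hz : φ 0 = ψ 0
  swap
  -- The zero of the monoid is central; its unit vector is a nonzero element of the algebra, so
  -- characters need not vanish there.
  · exact Or.inl (hcomm 0 hz fun x => by simp)
  have h01 : φ 0 = 0 ∨ φ 0 = 1 := by
    have := map_mul φ 0 0
    rw [mul_zero] at this
    grind
  have h00 := hd 0 0
  rw [mul_zero, ← hz] at h00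
  rcases h01 with h0 | h1
  swap
  -- With `φ 0 = ψ 0 = 1`, the rule at `0 * 0` gives `d 0 = 0`, and at `0 * x` it gives `d x = 0`.
  · refine Or.inl ⟨0, fun x => ?_⟩
    have := hd 0 x
    rw [zero_mul] at this
    grind
  have hψ0 : ψ 0 = 0 := hz ▸ h0
  have hd0 : d 0 = 0 := by simpa [h0] using h00
  by_cases harrow : ∀ a b, ∀ h : R a b, d (arrow a b h) = 0
  · left
    -- Vertices commute with everything except arrows, where `d` vanishes. So a vertex separating
    -- `φ` from `ψ` can serve as `z`; if there is none, idempotency kills `d` on vertices.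
    by_cases hv : ∃ v, φ (vertex v) ≠ ψ (vertex v)
    · obtain ⟨v, hv⟩ := hv
      refine hcomm _ hv fun x => ?_
      cases x with
      | one => exact Or.inl rfl
      | zero => exact Or.inl rfl
      | vertex w =>
        left
        rw [vertex_mul_vertex, vertex_mul_vertex]
        grind
      | arrow a b h =>
        exact Or.inr ⟨harrow a b h, by rw [map_arrow_eq_zero h0, map_arrow_eq_zero hψ0]⟩
    · push Not at hv
      refine ⟨0, fun x => ?_⟩
      rw [zero_mul]
      cases x with
      | one => simpa [one_def] using hd 1 1
      | zero => exact hd0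
      | vertex w =>
        have := hd (vertex w) (vertex w)
        rw [vertex_mul_self, ← hv] at this
        rcases map_vertex_eq_zero_or_one φ w with h | h <;> simpa [h] using this
      | arrow a b h => exact harrow a b h
  · right
    push Not at harrow
    obtain ⟨a, b, h, hab⟩ := harrow
    -- Both characters vanish on arrows, so absorbing the source on the left gives `φ (vertex a) =
    -- 1`, and the target on the right gives `ψ (vertex b) = 1`.
    refine ⟨a, b, h, eq_character h0 ?_, eq_character hψ0 ?_⟩
    · have := hd (vertex a) (arrow a b h)
      rw [vertex_mul_arrow, if_pos rfl, map_arrow_eq_zero hψ0, mul_zero, add_zero] at this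
      exact (mul_eq_right₀ hab).mp this.symm
    · have := hd (arrow a b h) (vertex b)
      rw [arrow_mul_vertex, if_pos rfl, map_arrow_eq_zero h0, zero_mul, zero_add] at this
      exact (mul_eq_left₀ hab).mp this.symm

open Classical in
/-- The coordinate of the arrow from `v` to `w`. -/
def arrowCoord (𝕜 : Type*) [Field 𝕜] (R : V → V → Prop) (v w : V) : PathMonoid R → 𝕜
  | arrow a b _ => if a = v ∧ b = w then 1 else 0
  | _ => 0

/-- Apart from factors `1`, an arrow factors only through its source on the left or its target on
the right, one for each term of the Leibniz rule. -/
theorem arrowCoord_mul (v w : V) (x y : PathMonoid R) : arrowCoord 𝕜 R v w (x * y) =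
    character 𝕜 R v x * arrowCoord 𝕜 R v w y + arrowCoord 𝕜 R v w x * character 𝕜 R w y := by
  have h1 : arrowCoord 𝕜 R v w 1 = 0 := rfl
  have h0 : arrowCoord 𝕜 R v w 0 = 0 := rfl
  have hv (a : V) : arrowCoord 𝕜 R v w (vertex a) = 0 := rfl
  cases x <;> cases y <;>
    simp only [one_def, zero_def, one_mul, mul_one, zero_mul, mul_zero, vertex_mul_vertex,
      vertex_mul_arrow, arrow_mul_vertex, arrow_mul_arrow, map_one, character_zero,
      character_vertex, character_arrow, h1, h0, hv, zero_add, add_zero] <;>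
    simp only [arrowCoord] <;> grind [arrowCoord]

end PathMonoid

/-! ### Recovering the relation from outer derivations of the path algebra. -/

/-- There is a continuous derivation from `A` into the one-dimensional bimodule with left action
`φ` and right action `ψ` that is not inner. -/
def HasOuterDerivation {𝕜 A : Type*} [RCLike 𝕜] [NormedRing A] [NormedAlgebra 𝕜 A]
    (φ ψ : A →A[𝕜] 𝕜) : Prop :=
  ∃ D : A →L[𝕜] 𝕜, (∀ a b, D (a * b) = φ a * D b + D a * ψ b) ∧
    ∀ c : 𝕜, ∃ a, D a ≠ c * (φ a - ψ a)

theorem HasOuterDerivation.comp_equiv {𝕜 A B : Type*} [RCLike 𝕜] [NormedRing A]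
    [NormedAlgebra 𝕜 A] [NormedRing B] [NormedAlgebra 𝕜 B] {φ ψ : A →A[𝕜] 𝕜}
    (h : HasOuterDerivation φ ψ) (e : B ≃A[𝕜] A) :
    HasOuterDerivation (φ.comp (e : B →A[𝕜] A)) (ψ.comp (e : B →A[𝕜] A)) := by
  obtain ⟨D, hD, hout⟩ := h
  refine ⟨⟨D.toLinearMap ∘ₗ e.toAlgEquiv.toLinearMap, D.continuous.comp e.continuous⟩, ?_, ?_⟩
  · intro a b
    change D (e (a * b)) = φ (e a) * D (e b) + D (e a) * ψ (e b)
    rw [map_mul, hD]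
  · intro c
    obtain ⟨a, ha⟩ := hout c
    refine ⟨e.symm a, ?_⟩
    change D (e (e.symm a)) ≠ c * (φ (e (e.symm a)) - ψ (e (e.symm a)))
    rwa [e.apply_symm_apply]

namespace PathMonoid

variable {V : Type u} {R : V → V → Prop} {𝕜 : Type*} [RCLike 𝕜]

/-- The character of the path algebra supported at the vertex `v`. -/
def algCharacter (𝕜 : Type*) [RCLike 𝕜] (R : V → V → Prop) (v : V) :
    EllOne 𝕜 (PathMonoid R) →A[𝕜] 𝕜 :=
  EllOne.liftAlgHom (character 𝕜 R v) 1 fun x => by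
    cases x with
    | one => exact norm_one.le
    | zero => simp [zero_def, character_zero]
    | vertex w => rw [character_vertex]; split_ifs <;> simp
    | arrow a b h => simp [character_arrow]

theorem algCharacter_basisVec (v : V) (x : PathMonoid R) :
    algCharacter 𝕜 R v (EllOne.basisVec x) = character 𝕜 R v x :=
  EllOne.liftAlgHom_basisVec _ _ _ x

theorem algCharacter_injective : Function.Injective (algCharacter 𝕜 R) := by
  intro v w h
  have := congrArg (fun φ => φ (EllOne.basisVec (vertex v))) h
  simp only [algCharacter_basisVec, character_vertex] at this
  by_contra hne
  simp [hne] at this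

theorem algHom_ext {S : Type*} [Monoid S] {φ ψ : EllOne 𝕜 S →A[𝕜] 𝕜}
    (h : ∀ s, φ (EllOne.basisVec s) = ψ (EllOne.basisVec s)) : φ = ψ := by
  have : φ.toContinuousLinearMap = ψ.toContinuousLinearMap := EllOne.clm_ext h
  ext a
  exact congrArg (fun T => T a) this

theorem hasOuterDerivation_algCharacter {v w : V} (h : R v w) :
    HasOuterDerivation (algCharacter 𝕜 R v) (algCharacter 𝕜 R w) := by
  have hb (x : PathMonoid R) : ‖arrowCoord 𝕜 R v w x‖ ≤ 1 := by
    cases x <;> simp only [arrowCoord] <;> (try split_ifs) <;> simp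
  set D : EllOne 𝕜 (PathMonoid R) →L[𝕜] 𝕜 := EllOne.lift (arrowCoord 𝕜 R v w) 1 hb with hD
  refine ⟨D, fun a b => ?_, fun c => ⟨EllOne.basisVec (arrow v w h), ?_⟩⟩
  · have : (ContinuousLinearMap.compL 𝕜 _ _ 𝕜 D).comp EllOne.mulCLM =
        (ContinuousLinearMap.mul 𝕜 𝕜).bilinearComp (algCharacter 𝕜 R v).toContinuousLinearMap D +
          (ContinuousLinearMap.mul 𝕜 𝕜).bilinearComp D (algCharacter 𝕜 R w).toContinuousLinearMap :=
      EllOne.clm_ext₂ fun x y => by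
      change D (EllOne.basisVec x * EllOne.basisVec y) =
        algCharacter 𝕜 R v (EllOne.basisVec x) * D (EllOne.basisVec y) +
          D (EllOne.basisVec x) * algCharacter 𝕜 R w (EllOne.basisVec y)
      rw [EllOne.basisVec_mul, algCharacter_basisVec, algCharacter_basisVec]
      simp only [hD, EllOne.lift_basisVec]
      exact arrowCoord_mul v w x y
    exact congrArg (fun B => B a b) this
  -- Every inner derivation vanishes on this arrow, while `D` takes the value `1`.
  · rw [algCharacter_basisVec, algCharacter_basisVec, character_arrow, character_arrow]
    simp [hD, arrowCoord]

theorem exists_of_hasOuterDerivation {φ ψ : EllOne 𝕜 (PathMonoid R) →A[𝕜] 𝕜}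
    (h : HasOuterDerivation φ ψ) :
    ∃ v w, R v w ∧ φ = algCharacter 𝕜 R v ∧ ψ = algCharacter 𝕜 R w := by
  obtain ⟨D, hD, hout⟩ := h
  let res (χ : EllOne 𝕜 (PathMonoid R) →A[𝕜] 𝕜) : PathMonoid R →* 𝕜 :=
    { toFun := fun x => χ (EllOne.basisVec x)
      map_one' := map_one χ
      map_mul' := fun x y => by rw [← EllOne.basisVec_mul, map_mul] }
  rcases inner_or_related (res φ) (res ψ) (fun x => D (EllOne.basisVec x)) (fun x y => by
    rw [← EllOne.basisVec_mul, hD]; rfl) with ⟨c, hc⟩ | ⟨v, w, hvw, h1, h2⟩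
  · obtain ⟨a, ha⟩ := hout c
    refine absurd ?_ ha
    have : D = c • (φ.toContinuousLinearMap - ψ.toContinuousLinearMap) := EllOne.clm_ext hc
    exact congrArg (fun T => T a) this
  · refine ⟨v, w, hvw, algHom_ext fun x => ?_, algHom_ext fun x => ?_⟩
    · rw [algCharacter_basisVec, ← h1]; rfl
    · rw [algCharacter_basisVec, ← h2]; rfl

theorem hasOuterDerivation_algCharacter_iff {v w : V} :
    HasOuterDerivation (algCharacter 𝕜 R v) (algCharacter 𝕜 R w) ↔ R v w := by
  refine ⟨fun h => ?_, hasOuterDerivation_algCharacter⟩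
  obtain ⟨v', w', hR, h1, h2⟩ := exists_of_hasOuterDerivation h
  rwa [algCharacter_injective h1, algCharacter_injective h2]

/-- If every vertex has an outgoing arrow, an isomorphism of path algebras induces an isomorphism
of the relations. -/
theorem nonempty_relIso {R' : V → V → Prop} (hR : ∀ v, ∃ w, R v w) (hR' : ∀ v, ∃ w, R' v w)
    (e : EllOne 𝕜 (PathMonoid R) ≃A[𝕜] EllOne 𝕜 (PathMonoid R')) : Nonempty (R ≃r R') := by
  -- The algebra also has characters that come from no vertex. An outgoing arrow puts the character
  -- of `v` in an outer pair, and the transported pair must again come from vertices.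
  have hex {R R' : V → V → Prop} (hR : ∀ v, ∃ w, R v w)
      (e : EllOne 𝕜 (PathMonoid R) ≃A[𝕜] EllOne 𝕜 (PathMonoid R')) (v : V) :
      ∃ v', (algCharacter 𝕜 R v).comp (e.symm : _ →A[𝕜] _) = algCharacter 𝕜 R' v' := by
    obtain ⟨w, hw⟩ := hR v
    obtain ⟨v', _, _, h, _⟩ := exists_of_hasOuterDerivation
      ((hasOuterDerivation_algCharacter (𝕜 := 𝕜) hw).comp_equiv e.symm)
    exact ⟨v', h⟩
  choose f hf using hex hR e
  choose g hg using hex hR' e.symm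
  have hgf (v : V) : g (f v) = v := by
    apply algCharacter_injective (𝕜 := 𝕜) (R := R)
    rw [← hg, ← hf]
    ext a
    exact congrArg (algCharacter 𝕜 R v) (e.symm_apply_apply a)
  have hfg (v : V) : f (g v) = v := by
    apply algCharacter_injective (𝕜 := 𝕜) (R := R')
    rw [← hf, ← hg]
    ext a
    exact congrArg (algCharacter 𝕜 R' v) (e.apply_symm_apply a)
  refine ⟨⟨⟨f, g, hgf, hfg⟩, fun {v w} => ?_⟩⟩
  change R' (f v) (f w) ↔ R v w
  rw [← hasOuterDerivation_algCharacter_iff (𝕜 := 𝕜) (R := R),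
    ← hasOuterDerivation_algCharacter_iff (𝕜 := 𝕜) (R := R')]
  constructor
  · intro h
    rw [← hgf v, ← hgf w, ← hg, ← hg]
    exact h.comp_equiv _
  · intro h
    rw [← hf, ← hf]
    exact h.comp_equiv _

end PathMonoid

/-! ### Rigid relations and the lower bound. -/

/-- A strict order with loops added at the points of `X`. -/
def loopedLT {V : Type u} [LT V] (X : Set V) (v w : V) : Prop := v < w ∨ v = w ∧ v ∈ X

/-- Off the diagonal the relation is the strict order, so `e` is an automorphism of a well-order,
hence the identity; the diagonal then reads off the set. -/
theorem loopedLT_injective {V : Type u} [LinearOrder V] [WellFoundedLT V] {X Y : Set V}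
    (e : loopedLT X ≃r loopedLT Y) : X = Y := by
  have hlt (v w : V) : e v < e w ↔ v < w := by
    have h1 := e.map_rel_iff (a := v) (b := w)
    have h2 : e v = e w ↔ v = w := e.injective.eq_iff
    simp only [loopedLT] at h1
    constructor
    · intro h
      rcases h1.mp (Or.inl h) with h | h
      · exact h
      · exact absurd (h2.mpr h.1) ‹e v < e w›.ne
    · intro h
      rcases h1.mpr (Or.inl h) with h' | h'
      · exact h'
      · exact absurd (h2.mp h'.1) h.ne
  let f : V ≃o V := OrderIso.ofRelIsoLT ⟨e.toEquiv, fun {v w} => hlt v w⟩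
  have hf (v : V) : e v = v := by
    have : f = OrderIso.refl V := Subsingleton.elim _ _
    exact congrArg (fun f : V ≃o V => f v) this
  ext v
  have := e.map_rel_iff (a := v) (b := v)
  rw [hf] at this
  simpa [loopedLT] using this.symm

namespace UnitalBanachAlgebra

theorem le_mk_isoTypes (𝕜 : Type) [RCLike 𝕜] {κ : Cardinal.{u}} (hκ : ℵ₀ ≤ κ) :
    Cardinal.lift.{u + 1} ((2 : Cardinal.{u}) ^ κ) ≤ #(IsoTypes.{u} 𝕜 κ) := by
  set V := κ.ord.ToType
  have hV : #V = κ := mk_ord_toType κ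
  have : Infinite V := infinite_iff.mpr (hκ.trans hV.ge)
  -- An infinite cardinal is a limit ordinal; hence every vertex has an outgoing arrow, whatever `X`
  -- is.
  have : NoMaxOrder V := noMaxOrder hκ
  have hd (X : Set V) : topDensity (EllOne 𝕜 (PathMonoid (loopedLT X))) = κ := by
    have : Infinite (PathMonoid (loopedLT X)) :=
      infinite_iff.mpr (by rw [PathMonoid.mk_eq, hV]; exact hκ)
    rw [EllOne.topDensity_eq, PathMonoid.mk_eq, hV]
  have hout (X : Set V) (v : V) : ∃ w, loopedLT X v w := (exists_gt v).imp fun _ h => Or.inl h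
  let F (X : Set V) : IsoTypes.{u} 𝕜 κ :=
    Quotient.mk (isoSetoid 𝕜 κ) ⟨⟨EllOne 𝕜 (PathMonoid (loopedLT X))⟩, hd X⟩
  have hF : Function.Injective F := by
    intro X Y h
    obtain ⟨e⟩ := Quotient.exact h
    obtain ⟨r⟩ := PathMonoid.nonempty_relIso (hout X) (hout Y) e
    exact loopedLT_injective r
  have h := lift_mk_le_lift_mk_of_injective hF
  rwa [mk_set, hV, lift_id'.{u, u + 1}] at h

end UnitalBanachAlgebra

end

theorem lemma2p5 (𝕜 : Type) [RCLike 𝕜] (κ : Cardinal.{u}) (hκ : ℵ₀ ≤ κ) :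
    (∀ (A : Type u) [NormedRing A] [NormedAlgebra 𝕜 A] [CompleteSpace A], topDensity A = κ →
      ∃ (I : Ideal (EllOne 𝕜 (FreeMonoid κ.out))) (_ : I.IsTwoSided),
        IsClosed (I : Set (EllOne 𝕜 (FreeMonoid κ.out))) ∧
          Nonempty ((EllOne 𝕜 (FreeMonoid κ.out) ⧸ I) ≃A[𝕜] A)) ∧
    #(UnitalBanachAlgebra.IsoTypes 𝕜 κ) = Cardinal.lift.{u + 1} ((2 : Cardinal.{u}) ^ κ) :=
  ⟨fun A _ _ _ hA => exists_ideal_quotient_equiv A hA,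
    (UnitalBanachAlgebra.mk_isoTypes_le 𝕜 hκ).antisymm (UnitalBanachAlgebra.le_mk_isoTypes 𝕜 hκ)⟩
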